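/- **Setting.** A measurement scenario $\langle X,\Sigma,O\rangle$ consists of a finite set $X$ of measurements, a finite non-empty outcome set $O_x$ for each $x\in X$, and a simplicial complex $\Sigma$ of contexts on $X$: a non-empty, downward closed family of subsets of $X$ containing all singletons. An empirical model $e$ on it is a family $(e_\sigma)_{\sigma\in\Sigma}$ of probability distributions, $e_\sigma$ on $\prod_{x\in\sigma}O_x$, such that $e_\tau$ is the marginal of $e_\sigma$ whenever $\tau\subseteq\sigma$. It is non-contextual if there is a distribution on $\prod_{x\in X}O_x$ whose marginal on each $\sigma\in\Sigma$ is $e_\sigma$. The non-contextual fraction $\mathsf{NCF}(e)$ is the maximum of all $\lambda\in[0,1]$ such that $e=\lambda e^{\mathrm{NC}}+(1-\lambda)e'$ for empirical models $e^{\mathrm{NC}},e'$ on the same scenario with $e^{\mathrm{NC}}$ non-contextual, and the contextual fraction is $\mathsf{CF}(e)=1-\mathsf{NCF}(e)$. *Tensor product.* For $e$ on $\langle X,\Sigma,O\rangle$ and $e'$ on $\langle X',\Sigma',O'\rangle$, the model $e\otimes e'$ has measurements $X\sqcup X'$ with their given outcome sets, contexts $\sigma\sqcup\sigma'$ with $\sigma\in\Sigma$,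 $\sigma'\in\Sigma'$, and $(e\otimes e')_{\sigma\sqcup\sigma'}(s,s')=e_\sigma(s)\,e'_{\sigma'}(s')$. *Measurement protocols.* A run is a finite sequence $\bar x=(x_i,o_i)_{i=1}^n$ with distinct $x_i$, $o_i\in O_{x_i}$ and $\sigma_{\bar x}=\{x_1,\dots,x_n\}\in\Sigma$; runs are consistent if they give equal outcomes to common measurements. A measurement protocol is a non-empty prefix-closed set $Q$ of runs such that $\bar x\cdot(x,o)\in Q$ implies $\bar x\cdot(x,o')\in Q$ for all $o'\in O_x$, and $\bar x\cdot(x,o),\ \bar x\cdot(x',o')\in Q$ implies $x=x'$. The scenario of protocols has the protocols as measurements; the outcomes of $Q$ are its maximal runs; a set $\{Q_1,\dots,Q_n\}$ is a context if $\bigcup_i\sigma_{\bar x_i}\in\Sigma$ for all pairwise consistent choices of runs $\bar x_i\in Q_i$. The model $\mathsf{MP}(e)$ on it gives to an assignment $Q_i\mapsto\bar x_i$ of maximal runs the probability, under $e_{\bigcup_i\sigma_{\bar x_i}}$, of the union of the assignments $\bar x_i$ if these are pairwise consistent, and $0$ otherwise. *Simulation.* A deterministic simulation $d\to e$, for $d$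 on $\langle Y,\Theta,P\rangle$ and $e$ on $\langle X,\Sigma,O\rangle$, consists of a map $\pi:X\to Y$ with $\pi(\sigma)\in\Theta$ for all $\sigma\in\Sigma$ and maps $h_x:P_{\pi(x)}\to O_x$ for $x\in X$, such that for every $\sigma\in\Sigma$ the distribution $e_\sigma$ is the pushforward of $d_{\pi(\sigma)}$ along $t\mapsto (h_x(t(\pi(x))))_{x\in\sigma}$. We say that $d$ simulates $e$, written $d\rightsquigarrow e$, if for some non-contextual empirical model $c$ there is a deterministic simulation $\mathsf{MP}(d\otimes c)\to e$. **Theorem.** Let $d$ and $e$ be empirical models. If $d\rightsquigarrow e$, then $\mathsf{NCF}(d)\le\mathsf{NCF}(e)$; equivalently, $\mathsf{CF}(e)\le\mathsf{CF}(d)$. -/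

import Mathlib

open Convexity

universe u v

namespace Contextuality

/-! ### Finitely supported distributions

`StdSimplex ℝ A` is the set of finitely supported probability distributions on `A`, and
`StdSimplex.map` is the pushforward of distributions along a function. -/

/-- The value of a pushforward: sum over the fibre. -/
theorem map_weights_apply {A B : Type*} [Fintype A] [DecidableEq B] (p : StdSimplex ℝ A)
    (f : A → B) (b : B) :
    (p.map f).weights b = ∑ a with f a = b, p.weights a := by
  classical
  rw [StdSimplex.weights_map, Finsupp.mapDomain, Finsupp.sum_fintype _ _ (by simp),
    Finsupp.finsetSum_apply, Finset.sum_filter]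
  exact Finset.sum_congr rfl fun a _ => by rw [Finsupp.single_apply]

/-- The distribution on a finite type with prescribed values. -/
noncomputable def distOfFun {A : Type*} [Fintype A] (f : A → ℝ) (h0 : ∀ a, 0 ≤ f a)
    (h1 : ∑ a, f a = 1) : StdSimplex ℝ A where
  weights := Finsupp.equivFunOnFinite.symm f
  nonneg := fun a => h0 a
  total := by rw [Finsupp.sum_fintype _ _ (by simp)]; exact h1

@[simp] theorem distOfFun_apply {A : Type*} [Fintype A] (f : A → ℝ) (h0 h1) (a : A) :
    (distOfFun f h0 h1).weights a = f a := rfl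

theorem sum_weights {A : Type*} [Fintype A] (p : StdSimplex ℝ A) : ∑ a, p.weights a = 1 := by
  rw [← p.total, Finsupp.sum_fintype _ _ (by simp)]

/-! ### Scenarios and empirical models -/

/-- A measurement scenario: a finite set of measurements, a finite non-empty set of outcomes for
each measurement, and a simplicial complex of contexts. A simplicial complex is a non-empty,
downward closed family of finite sets that contains all singletons (so the empty set is a face);
finiteness of the faces is automatic here. -/
structure Scenario where
  Meas : Type u
  Out : Meas → Type u
  contexts : Set (Set Meas)
  finite_meas : Finite Meas
  finite_out : ∀ x, Finite (Out x)
  nonempty_out : ∀ x, Nonempty (Out x)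
  contexts_nonempty : contexts.Nonempty
  down_closed : ∀ σ ∈ contexts, ∀ τ ⊆ σ, τ ∈ contexts
  singleton_mem : ∀ x, {x} ∈ contexts

attribute [instance] Scenario.finite_meas Scenario.finite_out Scenario.nonempty_out

namespace Scenario

theorem empty_mem (S : Scenario.{u}) : ∅ ∈ S.contexts := by
  obtain ⟨σ, hσ⟩ := S.contexts_nonempty
  exact S.down_closed σ hσ ∅ (Set.empty_subset σ)

/-- The joint outcomes `∏_{x ∈ U} O_x` (the event sheaf at `U`); its restriction maps are
`Set.domRestrict₂`. -/
abbrev Sections (S : Scenario.{u}) (U : Set S.Meas) : Type u := (x : U) → S.Out x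

/-- The joint outcomes of all measurements. -/
abbrev Global (S : Scenario.{u}) : Type u := (x : S.Meas) → S.Out x

noncomputable instance (S : Scenario.{u}) (U : Set S.Meas) : Fintype (S.Sections U) :=
  Fintype.ofFinite _

noncomputable instance (S : Scenario.{u}) : Fintype S.Global := Fintype.ofFinite _

noncomputable instance (S : Scenario.{u}) (x : S.Meas) : Fintype (S.Out x) := Fintype.ofFinite _

end Scenario

/-- An empirical model: a family of distributions, one for each context, on the joint outcomes
of that context, compatible with marginalization. -/
structure EmpiricalModel (S : Scenario.{u}) where
  dist : (σ : Set S.Meas) → σ ∈ S.contexts → StdSimplex ℝ (S.Sections σ)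
  compat : ∀ (σ τ : Set S.Meas) (hσ : σ ∈ S.contexts) (hτ : τ ∈ S.contexts) (h : τ ⊆ σ),
    dist τ hτ = (dist σ hσ).map (Set.domRestrict₂ h)

namespace EmpiricalModel

variable {S : Scenario.{u}}

@[ext] theorem ext' {e e' : EmpiricalModel S}
    (h : ∀ σ hσ s, (e.dist σ hσ).weights s = (e'.dist σ hσ).weights s) : e = e' := by
  obtain ⟨a, ha⟩ := e
  obtain ⟨b, hb⟩ := e'
  have : a = b := by
    funext σ hσ
    ext s
    exact h σ hσ s
  subst this
  rfl

/-- Evaluation of an empirical model only depends on the context and on the joint outcome. -/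
theorem weights_congr (e : EmpiricalModel S) {σ τ : Set S.Meas} (hσ : σ ∈ S.contexts)
    (hτ : τ ∈ S.contexts) (h : σ = τ) (s : S.Sections σ) (t : S.Sections τ)
    (hst : ∀ x (hx : x ∈ σ) (hx' : x ∈ τ), s ⟨x, hx⟩ = t ⟨x, hx'⟩) :
    (e.dist σ hσ).weights s = (e.dist τ hτ).weights t := by
  subst h
  have : s = t := funext fun x => hst x.1 x.2 x.2
  rw [this]

/-- `e` is non-contextual: it arises from a distribution on global assignments by
marginalization. -/
def NonContextual (e : EmpiricalModel S) : Prop :=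
  ∃ p : StdSimplex ℝ S.Global, ∀ (σ : Set S.Meas) (hσ : σ ∈ S.contexts),
    p.map (Set.domRestrict σ) = e.dist σ hσ

/-- Probabilistic mixing `e +_c e'`, given by `c e_σ(s) + (1 - c) e'_σ(s)`. -/
noncomputable def mix (c : ℝ) (h0 : 0 ≤ c) (h1 : c ≤ 1) (e e' : EmpiricalModel S) :
    EmpiricalModel S where
  dist σ hσ := convexCombPair c (1 - c) h0 (sub_nonneg.2 h1) (add_sub_cancel c 1)
    (e.dist σ hσ) (e'.dist σ hσ)
  compat σ τ hσ hτ h := by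
    ext : 1
    rw [e.compat σ τ hσ hτ h, e'.compat σ τ hσ hτ h]
    simp [Finsupp.mapDomain_add, Finsupp.mapDomain_smul]

theorem mix_apply (c : ℝ) (h0 : 0 ≤ c) (h1 : c ≤ 1) (e e' : EmpiricalModel S)
    (σ : Set S.Meas) (hσ : σ ∈ S.contexts) (s : S.Sections σ) :
    ((mix c h0 h1 e e').dist σ hσ).weights s =
      c * (e.dist σ hσ).weights s + (1 - c) * (e'.dist σ hσ).weights s := by
  simp [mix]

/-- The coefficients `c` of all decompositions `e = e₀ +_c e₁` with `e₀` non-contextual. -/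
def ncWeights (e : EmpiricalModel S) : Set ℝ :=
  {c | ∃ (h0 : 0 ≤ c) (h1 : c ≤ 1) (e₀ e₁ : EmpiricalModel S),
    e₀.NonContextual ∧ e = mix c h0 h1 e₀ e₁}

/-- The non-contextual fraction: the maximum of `ncWeights e` (attained, see `isGreatest_ncf`). -/
noncomputable def ncf (e : EmpiricalModel S) : ℝ := sSup (ncWeights e)

/-- The contextual fraction. -/
noncomputable def cf (e : EmpiricalModel S) : ℝ := 1 - ncf e

/-- The non-contextual model given by a distribution on global assignments. -/
noncomputable def ofGlobal (p : StdSimplex ℝ S.Global) : EmpiricalModel S where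
  dist σ _ := p.map (Set.domRestrict σ)
  compat σ τ _ _ h := by rw [StdSimplex.map_map]; rfl

section Attained

open scoped Classical

/-- `b` is a non-negative weight on global assignments whose marginals lie below `e`. -/
def IsSubweight (e : EmpiricalModel S) (b : S.Global → ℝ) : Prop :=
  (∀ g, 0 ≤ b g) ∧ ∀ (σ : Set S.Meas) (hσ : σ ∈ S.contexts) (s : S.Sections σ),
    ∑ g, (if Set.domRestrict σ g = s then b g else 0) ≤ (e.dist σ hσ).weights s

theorem ofGlobal_apply (p : StdSimplex ℝ S.Global) (σ : Set S.Meas) (hσ : σ ∈ S.contexts)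
    (s : S.Sections σ) : ((ofGlobal p).dist σ hσ).weights s =
      ∑ g, if Set.domRestrict σ g = s then p.weights g else 0 := by
  rw [← Finset.sum_filter]
  exact map_weights_apply _ _ _

theorem sum_fibres (b : S.Global → ℝ) (σ : Set S.Meas) :
    ∑ s : S.Sections σ, ∑ g, (if Set.domRestrict σ g = s then b g else 0) = ∑ g, b g := by
  rw [Finset.sum_comm]
  simp

theorem sum_fibres_restrict (b : S.Global → ℝ) {σ τ : Set S.Meas} (h : τ ⊆ σ)
    (t : S.Sections τ) :
    ∑ s : S.Sections σ with Set.domRestrict₂ h s = t,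
      ∑ g, (if Set.domRestrict σ g = s then b g else 0) =
      ∑ g, (if Set.domRestrict τ g = t then b g else 0) := by
  rw [Finset.sum_comm]
  refine Finset.sum_congr rfl fun g _ => ?_
  rw [Finset.sum_filter, Finset.sum_eq_single (Set.domRestrict σ g)]
  · rw [if_pos rfl]
    rfl
  · intro s _ hs
    rw [if_neg hs.symm, ite_self]
  · simp

theorem IsSubweight.sum_le {e : EmpiricalModel S} {b : S.Global → ℝ} (hb : e.IsSubweight b) :
    ∑ g, b g ≤ 1 := by
  rw [← sum_fibres b ∅, ← sum_weights (e.dist ∅ S.empty_mem)]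
  exact Finset.sum_le_sum fun s _ => hb.2 ∅ S.empty_mem s

theorem IsSubweight.mem {e : EmpiricalModel S} {b : S.Global → ℝ} (hb : e.IsSubweight b) :
    ∑ g, b g ∈ ncWeights e := by
  set c : ℝ := ∑ g, b g with hc
  have h0 : 0 ≤ c := Finset.sum_nonneg fun g _ => hb.1 g
  have h1 : c ≤ 1 := hb.sum_le
  obtain ⟨p, hp⟩ : ∃ p : StdSimplex ℝ S.Global, ∀ g, b g = c * p.weights g := by
    rcases h0.eq_or_lt with h | h
    · refine ⟨StdSimplex.single (Classical.arbitrary _), fun g => ?_⟩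
      rw [← h, zero_mul]
      exact (Finset.sum_eq_zero_iff_of_nonneg fun g _ => hb.1 g).1 h.symm g (Finset.mem_univ g)
    · refine ⟨distOfFun (fun g => c⁻¹ * b g)
        (fun g => mul_nonneg (inv_nonneg.2 h0) (hb.1 g)) ?_, fun g => ?_⟩
      · rw [← Finset.mul_sum, ← hc, inv_mul_cancel₀ h.ne']
      · rw [distOfFun_apply, mul_inv_cancel_left₀ h.ne']
  have hmarg : ∀ (σ : Set S.Meas) (hσ : σ ∈ S.contexts) (s : S.Sections σ),
      c * ((ofGlobal p).dist σ hσ).weights s =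
        ∑ g, (if Set.domRestrict σ g = s then b g else 0) := by
    intro σ hσ s
    rw [ofGlobal_apply, Finset.mul_sum]
    refine Finset.sum_congr rfl fun g _ => ?_
    rw [mul_ite, mul_zero, hp]
  obtain ⟨e₁, he₁⟩ : ∃ e₁ : EmpiricalModel S, ∀ σ hσ s, (1 - c) * (e₁.dist σ hσ).weights s =
      (e.dist σ hσ).weights s - ∑ g, (if Set.domRestrict σ g = s then b g else 0) := by
    have hsum : ∀ (σ : Set S.Meas) (hσ : σ ∈ S.contexts), ∑ s, ((e.dist σ hσ).weights s -
        ∑ g, (if Set.domRestrict σ g = s then b g else 0)) = 1 - c := by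
      intro σ hσ
      rw [Finset.sum_sub_distrib, sum_weights, sum_fibres]
    rcases h1.eq_or_lt with h | h
    · refine ⟨e, fun σ hσ s => ?_⟩
      have := hsum σ hσ
      rw [h, sub_self, Finset.sum_eq_zero_iff_of_nonneg
        fun s _ => sub_nonneg.2 (hb.2 σ hσ s)] at this
      rw [this s (Finset.mem_univ s), h, sub_self, zero_mul]
    · have h' : 0 < 1 - c := sub_pos.2 h
      refine ⟨⟨fun σ hσ => distOfFun (fun s => (1 - c)⁻¹ * ((e.dist σ hσ).weights s -
          ∑ g, (if Set.domRestrict σ g = s then b g else 0)))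
          (fun s => mul_nonneg (inv_nonneg.2 h'.le) (sub_nonneg.2 (hb.2 σ hσ s)))
          (by rw [← Finset.mul_sum, hsum σ hσ, inv_mul_cancel₀ h'.ne']), ?_⟩, ?_⟩
      · intro σ τ hσ hτ hτσ
        ext t
        rw [map_weights_apply]
        simp only [distOfFun_apply]
        rw [← Finset.mul_sum, Finset.sum_sub_distrib, sum_fibres_restrict b hτσ t,
          e.compat σ τ hσ hτ hτσ, map_weights_apply]
      · intro σ hσ s
        rw [distOfFun_apply, mul_inv_cancel_left₀ h'.ne']
  refine ⟨h0, h1, ofGlobal p, e₁, ⟨p, fun _ _ => rfl⟩, ext' fun σ hσ s => ?_⟩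
  rw [mix_apply, hmarg, he₁]
  ring

theorem exists_isSubweight {e : EmpiricalModel S} {c : ℝ} (hc : c ∈ ncWeights e) :
    ∃ b, e.IsSubweight b ∧ ∑ g, b g = c := by
  obtain ⟨h0, h1, e₀, e₁, ⟨p, hp⟩, rfl⟩ := hc
  refine ⟨fun g => c * p.weights g, ⟨fun g => mul_nonneg h0 (StdSimplex.weights_nonneg g),
    fun σ hσ s => ?_⟩, by rw [← Finset.mul_sum, sum_weights, mul_one]⟩
  have : ∑ g, (if Set.domRestrict σ g = s then c * p.weights g else 0) =
      c * (e₀.dist σ hσ).weights s := by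
    rw [← hp σ hσ, map_weights_apply, Finset.mul_sum, Finset.sum_filter]
  rw [this, mix_apply]
  exact le_add_of_nonneg_right
    (mul_nonneg (sub_nonneg.2 h1) (StdSimplex.weights_nonneg s))

/-- The maximum in the definition of the non-contextual fraction is attained. -/
theorem isGreatest_ncf (e : EmpiricalModel S) : IsGreatest (ncWeights e) (ncf e) := by
  have himage : ncWeights e = (fun b : S.Global → ℝ => ∑ g, b g) '' {b | e.IsSubweight b} := by
    ext c
    constructor
    · exact fun hc => exists_isSubweight hc
    · rintro ⟨b, hb, rfl⟩
      exact hb.mem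
  have hclosed : IsClosed {b | e.IsSubweight b} := by
    have h1 : IsClosed {b : S.Global → ℝ | ∀ g, 0 ≤ b g} := by
      simp only [Set.ofPred_forall]
      exact isClosed_iInter fun g => isClosed_le continuous_const (continuous_apply g)
    have h2 : IsClosed {b : S.Global → ℝ | ∀ (σ : Set S.Meas) (hσ : σ ∈ S.contexts)
        (s : S.Sections σ), ∑ g, (if Set.domRestrict σ g = s then b g else 0) ≤
          (e.dist σ hσ).weights s} := by
      simp only [Set.ofPred_forall]
      refine isClosed_iInter fun σ => isClosed_iInter fun hσ => isClosed_iInter fun s =>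
        isClosed_le (continuous_finsetSum _ fun g _ => ?_) continuous_const
      split_ifs
      · exact continuous_apply g
      · exact continuous_const
    exact h1.inter h2
  have hcompact : IsCompact {b | e.IsSubweight b} := by
    refine (isCompact_Icc (a := (0 : S.Global → ℝ)) (b := 1)).of_isClosed_subset hclosed ?_
    intro b hb
    refine ⟨hb.1, fun g => le_trans ?_ hb.sum_le⟩
    exact Finset.single_le_sum (f := b) (fun g _ => hb.1 g) (Finset.mem_univ g)
  have hne : {b | e.IsSubweight b}.Nonempty := by
    refine ⟨fun _ => 0, fun _ => le_rfl, fun σ hσ s => ?_⟩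
    simp
  rw [ncf, himage]
  exact (hcompact.image (by fun_prop)).isGreatest_sSup (hne.image _)

end Attained

end EmpiricalModel

/-! ### Deterministic simulations -/

/-- A deterministic morphism `T → S` of scenarios: a simplicial map from the measurements of `S`
to those of `T`, and maps interpreting outcomes of `T` as outcomes of `S`. -/
structure DetMorphism (T : Scenario.{v}) (S : Scenario.{u}) where
  toFun : S.Meas → T.Meas
  simplicial : ∀ σ ∈ S.contexts, toFun '' σ ∈ T.contexts
  out : (x : S.Meas) → T.Out (toFun x) → S.Out x

namespace DetMorphism

variable {T : Scenario.{v}} {S : Scenario.{u}}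

/-- The component at `σ` of the natural transformation induced by the maps on outcomes. -/
def onSections (f : DetMorphism T S) (σ : Set S.Meas) (t : T.Sections (f.toFun '' σ)) :
    S.Sections σ :=
  fun x => f.out x (t ⟨f.toFun x, Set.mem_image_of_mem f.toFun x.2⟩)

/-- The pushforward of an empirical model along a deterministic morphism. -/
noncomputable def push (f : DetMorphism T S) (d : EmpiricalModel T) : EmpiricalModel S where
  dist σ hσ := (d.dist (f.toFun '' σ) (f.simplicial σ hσ)).map (f.onSections σ)
  compat σ τ hσ hτ h := by
    rw [d.compat _ _ (f.simplicial σ hσ) (f.simplicial τ hτ) (Set.image_mono h),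
      StdSimplex.map_map, StdSimplex.map_map]
    rfl

end DetMorphism

/-! ### Tensor product -/

namespace Scenario

/-- The outcomes on a disjoint union of measurements. -/
def sumOut (S T : Scenario.{u}) : S.Meas ⊕ T.Meas → Type u :=
  Sum.elim S.Out T.Out

/-- The tensor product of scenarios: disjoint union of the measurements, with the simplicial
join as compatibility structure. A set of measurements of the disjoint union is `σ ⊔ σ'`
with `σ` and `σ'` its preimages under the two inclusions. -/
def tensor (S T : Scenario.{u}) : Scenario.{u} where
  Meas := S.Meas ⊕ T.Meas
  Out := sumOut S T
  contexts := {ρ | Sum.inl ⁻¹' ρ ∈ S.contexts ∧ Sum.inr ⁻¹' ρ ∈ T.contexts}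
  finite_meas := inferInstance
  finite_out x := by cases x <;> simp only [sumOut, Sum.elim_inl, Sum.elim_inr] <;> infer_instance
  nonempty_out x := by
    cases x <;> simp only [sumOut, Sum.elim_inl, Sum.elim_inr] <;> infer_instance
  contexts_nonempty := ⟨∅, by simpa using S.empty_mem, by simpa using T.empty_mem⟩
  down_closed ρ hρ ρ' h :=
    ⟨S.down_closed _ hρ.1 _ (Set.preimage_mono h), T.down_closed _ hρ.2 _ (Set.preimage_mono h)⟩
  singleton_mem x := by
    cases x with
    | inl x =>
      refine ⟨?_, ?_⟩
      · convert S.singleton_mem x using 1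
        ext; simp
      · convert T.empty_mem using 1
        ext; simp
    | inr x =>
      refine ⟨?_, ?_⟩
      · convert S.empty_mem using 1
        ext; simp
      · convert T.singleton_mem x using 1
        ext; simp

variable {S T : Scenario.{u}}

/-- The left inclusion of measurements. -/
def inl (T : Scenario.{u}) (x : S.Meas) : (S.tensor T).Meas := Sum.inl x

/-- The right inclusion of measurements. -/
def inr (S : Scenario.{u}) (x : T.Meas) : (S.tensor T).Meas := Sum.inr x

theorem left_mem {ρ : Set (S.tensor T).Meas} (hρ : ρ ∈ (S.tensor T).contexts) :
    inl T ⁻¹' ρ ∈ S.contexts := hρ.1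

theorem right_mem {ρ : Set (S.tensor T).Meas} (hρ : ρ ∈ (S.tensor T).contexts) :
    inr S ⁻¹' ρ ∈ T.contexts := hρ.2

/-- A joint outcome of a tensor product is a pair of joint outcomes. -/
def secEquiv (ρ : Set (S.tensor T).Meas) :
    (S.tensor T).Sections ρ ≃ S.Sections (inl T ⁻¹' ρ) × T.Sections (inr S ⁻¹' ρ) where
  toFun s := (fun x => s ⟨inl T x.1, x.2⟩, fun x => s ⟨inr S x.1, x.2⟩)
  invFun p := fun x => match x with
    | ⟨Sum.inl x, hx⟩ => p.1 ⟨x, hx⟩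
    | ⟨Sum.inr x, hx⟩ => p.2 ⟨x, hx⟩
  left_inv s := by
    funext x
    obtain ⟨x | x, hx⟩ := x <;> rfl
  right_inv p := rfl

end Scenario

namespace EmpiricalModel

open Scenario

/-- The tensor product of empirical models:
`(e ⊗ e')_{σ ⊔ σ'} (s, s') = e_σ(s) e'_{σ'}(s')`. -/
noncomputable def tensor {S T : Scenario.{u}} (e : EmpiricalModel S) (e' : EmpiricalModel T) :
    EmpiricalModel (S.tensor T) where
  dist ρ hρ := distOfFun
    (fun s => (e.dist (inl T ⁻¹' ρ) (left_mem hρ)).weights (secEquiv ρ s).1 *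
      (e'.dist (inr S ⁻¹' ρ) (right_mem hρ)).weights (secEquiv ρ s).2)
    (fun s => mul_nonneg (StdSimplex.weights_nonneg _) (StdSimplex.weights_nonneg _))
    (by
      rw [Fintype.sum_equiv (secEquiv ρ) _
        (fun p => (e.dist (inl T ⁻¹' ρ) (left_mem hρ)).weights p.1 *
          (e'.dist (inr S ⁻¹' ρ) (right_mem hρ)).weights p.2) (fun s => rfl),
        Fintype.sum_prod_type, ← Fintype.sum_mul_sum, sum_weights, sum_weights, one_mul])
  compat ρ ρ' hρ hρ' h := by
    classical
    ext s'
    rw [map_weights_apply, distOfFun_apply,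
      e.compat _ _ (left_mem hρ) (left_mem hρ') (Set.preimage_mono h),
      e'.compat _ _ (right_mem hρ) (right_mem hρ') (Set.preimage_mono h),
      map_weights_apply, map_weights_apply,
      Finset.sum_mul_sum, ← Finset.sum_product']
    symm
    refine Finset.sum_bij' (fun s _ => secEquiv ρ s) (fun p _ => (secEquiv ρ).symm p)
      ?_ ?_ ?_ ?_ ?_
    · intro s hs
      simp only [Finset.mem_filter, Finset.mem_univ, true_and, Finset.mem_product] at hs ⊢
      subst hs
      exact ⟨rfl, rfl⟩
    · intro p hp
      simp only [Finset.mem_filter, Finset.mem_univ, true_and, Finset.mem_product] at hp ⊢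
      apply (secEquiv ρ').injective
      exact Prod.ext hp.1 hp.2
    · intro s _
      exact (secEquiv ρ).symm_apply_apply s
    · intro p _
      exact (secEquiv ρ).apply_symm_apply p
    · intro s _
      rfl

end EmpiricalModel

/-! ### Measurement protocols -/

namespace Scenario

variable (S : Scenario.{u})

/-- A pair `(x, o)` of a measurement and one of its outcomes. -/
abbrev Event : Type u := (x : S.Meas) × S.Out x

variable {S}

/-- The set of measurements performed in a sequence of measurement-outcome pairs. -/
def support (l : List S.Event) : Set S.Meas := {x | ∃ o, (⟨x, o⟩ : S.Event) ∈ l}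

/-- A run: the measurements are distinct and form a context. -/
def IsRun (l : List S.Event) : Prop :=
  (l.map Sigma.fst).Nodup ∧ support l ∈ S.contexts

/-- Two runs are consistent if they agree on common measurements. -/
def Consistent (l l' : List S.Event) : Prop :=
  ∀ (x : S.Meas) (o o' : S.Out x), (⟨x, o⟩ : S.Event) ∈ l → (⟨x, o'⟩ : S.Event) ∈ l' → o = o'

/-- The joint assignment determined by a family of runs on the union of their contexts: it sends
`x` to an outcome `o` such that `(x, o)` occurs in some run of the family. For pairwise
consistent runs this is the union of their assignments. -/
noncomputable def glue {I : Type*} (r : I → List S.Event) :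
    S.Sections (⋃ i, support (r i)) :=
  fun x => (Set.mem_iUnion.1 x.2).choose_spec.choose

end Scenario

open Scenario

/-- A measurement protocol: a non-empty prefix-closed set of runs, in which the outcomes observed
so far determine the next measurement, and every outcome of a performed measurement may occur. -/
@[ext] structure Protocol (S : Scenario.{u}) where
  runs : Set (List S.Event)
  isRun : ∀ l ∈ runs, IsRun l
  nonempty : runs.Nonempty
  prefix_closed : ∀ l l', l ++ l' ∈ runs → l ∈ runs
  all_outcomes : ∀ (l : List S.Event) (x : S.Meas) (o o' : S.Out x),
    l ++ [⟨x, o⟩] ∈ runs → l ++ [⟨x, o'⟩] ∈ runs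
  deterministic : ∀ (l : List S.Event) (x x' : S.Meas) (o : S.Out x) (o' : S.Out x'),
    l ++ [⟨x, o⟩] ∈ runs → l ++ [⟨x', o'⟩] ∈ runs → x = x'

namespace Protocol

variable {S : Scenario.{u}}

/-- A maximal run of a protocol: one that is not a proper prefix of another. -/
def IsMaximal (Q : Protocol S) (l : List S.Event) : Prop :=
  l ∈ Q.runs ∧ ∀ l' ∈ Q.runs, l <+: l' → l' = l

/-- The outcomes of a protocol are its maximal runs. -/
abbrev Outcome (Q : Protocol S) : Type u := {l : List S.Event // Q.IsMaximal l}

/-- A set of protocols is compatible if, for any choice of pairwise consistent runs, one from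
each protocol, the union of their contexts is a context. -/
def Compatible (τ : Set (Protocol S)) : Prop :=
  ∀ r : τ → List S.Event, (∀ Q : τ, r Q ∈ Q.1.runs) → (∀ Q Q' : τ, Consistent (r Q) (r Q')) →
    (⋃ Q, support (r Q)) ∈ S.contexts

end Protocol

namespace Scenario

variable {S : Scenario.{u}}

theorem support_nil : support ([] : List S.Event) = ∅ := by
  ext x; simp [support]

theorem consistent_nil_left (l : List S.Event) : Consistent [] l := by
  intro x o o' h; simp at h

theorem consistent_nil_right (l : List S.Event) : Consistent l [] := by
  intro x o o' _ h; simp at h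

theorem IsRun.nodup {l : List S.Event} (h : IsRun l) : l.Nodup := h.1.of_map _

theorem IsRun.length_le {l : List S.Event} (h : IsRun l) : l.length ≤ Nat.card S.Meas := by
  classical
  have := Fintype.ofFinite S.Meas
  have := h.1.length_le_card
  simpa [Nat.card_eq_fintype_card] using this

end Scenario

namespace Protocol

variable {S : Scenario.{u}}

theorem nil_mem (Q : Protocol S) : [] ∈ Q.runs := by
  obtain ⟨l, hl⟩ := Q.nonempty
  exact Q.prefix_closed [] l hl

instance : Finite {l : List S.Event // IsRun l} := by
  classical
  have : Fintype S.Event := Fintype.ofFinite _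
  exact Finite.of_injective
    (fun l : {l : List S.Event // IsRun l} => (⟨l.1, l.2.nodup⟩ : {l : List S.Event // l.Nodup}))
    (fun _ _ h => Subtype.ext (congrArg (fun z => z.1) h))

instance : Finite (Protocol S) := by
  refine Finite.of_injective
    (fun Q : Protocol S => {l : {l : List S.Event // IsRun l} | l.1 ∈ Q.runs}) ?_
  intro Q Q' h
  replace h := Set.ext_iff.1 h
  ext l
  exact ⟨fun hl => (h ⟨l, Q.isRun l hl⟩).1 hl, fun hl => (h ⟨l, Q'.isRun l hl⟩).2 hl⟩

instance (Q : Protocol S) : Finite Q.Outcome :=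
  Finite.of_injective
    (fun l : Q.Outcome => (⟨l.1, Q.isRun _ l.2.1⟩ : {l : List S.Event // IsRun l}))
    (fun _ _ h => Subtype.ext (congrArg (fun z => z.1) h))

instance (Q : Protocol S) : Nonempty Q.Outcome := by
  let A : Set ℕ := {n | ∃ l ∈ Q.runs, l.length = n}
  have hb : BddAbove A := ⟨Nat.card S.Meas, by
    rintro _ ⟨l, hl, rfl⟩
    exact (Q.isRun l hl).length_le⟩
  have hA : A.Nonempty := ⟨0, [], Q.nil_mem, rfl⟩
  obtain ⟨l, hl, hn⟩ := Nat.sSup_mem hA hb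
  refine ⟨⟨l, hl, fun l' hl' hp => ?_⟩⟩
  have h1 : l'.length ≤ sSup A := le_csSup hb ⟨l', hl', rfl⟩
  exact (hp.eq_of_length_le (by omega)).symm

theorem Compatible.mono {τ τ' : Set (Protocol S)} (hτ : Compatible τ) (h : τ' ⊆ τ) :
    Compatible τ' := by
  classical
  intro r hr hc
  have := hτ (fun Q => if hQ : Q.1 ∈ τ' then r ⟨Q.1, hQ⟩ else [])
    (fun Q => by
      by_cases hQ : Q.1 ∈ τ'
      · simpa [hQ] using hr ⟨Q.1, hQ⟩
      · simpa [hQ] using Q.1.nil_mem)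
    (fun Q Q' => by
      by_cases hQ : Q.1 ∈ τ'
      · by_cases hQ' : Q'.1 ∈ τ'
        · simpa [hQ, hQ'] using hc _ _
        · simpa [hQ, hQ'] using consistent_nil_right _
      · simpa [hQ] using consistent_nil_left _)
  refine S.down_closed _ this _ ?_
  intro x hx
  obtain ⟨Q, hQ⟩ := Set.mem_iUnion.1 hx
  refine Set.mem_iUnion.2 ⟨⟨Q.1, h Q.2⟩, ?_⟩
  simpa using hQ

theorem compatible_singleton (Q : Protocol S) : Compatible {Q} := by
  intro r hr _
  refine S.down_closed _ (Q.isRun _ (hr ⟨Q, rfl⟩)).2 _ ?_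
  intro x hx
  obtain ⟨⟨Q', hQ'⟩, h⟩ := Set.mem_iUnion.1 hx
  obtain rfl : Q' = Q := hQ'
  exact h

end Protocol

/-- The scenario of measurement protocols. -/
def Scenario.mp (S : Scenario.{u}) : Scenario.{u} where
  Meas := Protocol S
  Out Q := Q.Outcome
  contexts := {τ | Protocol.Compatible τ}
  finite_meas := inferInstance
  finite_out _ := inferInstance
  nonempty_out _ := inferInstance
  contexts_nonempty := ⟨∅, fun r _ _ => by simpa using S.empty_mem⟩
  down_closed _ hτ _ h := hτ.mono h
  singleton_mem := Protocol.compatible_singleton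

namespace EmpiricalModel

variable {S : Scenario.{u}}

/-- The weight of an assignment `Q ↦ s Q` of maximal runs to the protocols of a compatible set:
the probability of the joint assignment if the runs are pairwise consistent, and zero otherwise. -/
noncomputable def mpWeight (e : EmpiricalModel S) (τ : Set S.mp.Meas)
    (hτ : τ ∈ S.mp.contexts) (s : S.mp.Sections τ) : ℝ :=
  open Classical in
  if h : ∀ Q Q' : τ, Consistent (s Q).1 (s Q').1 then
    (e.dist (⋃ Q, support (s Q).1) (hτ (fun Q => (s Q).1) (fun Q => (s Q).2.1) h)).weights
      (glue fun Q => (s Q).1)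
  else 0

/-- The probability of a set of measurement-outcome pairs; zero if it is not the graph of an
assignment on a context. -/
noncomputable def graphWeight (e : EmpiricalModel S) (A : Set S.Event) : ℝ :=
  open Classical in
  if h : {x | ∃ o, (⟨x, o⟩ : S.Event) ∈ A} ∈ S.contexts ∧
      ∀ x (o o' : S.Out x), (⟨x, o⟩ : S.Event) ∈ A → (⟨x, o'⟩ : S.Event) ∈ A → o = o' then
    (e.dist _ h.1).weights fun x => x.2.choose
  else 0

theorem graphWeight_eq_zero (e : EmpiricalModel S) (A : Set S.Event)
    (h : ¬ ∀ x (o o' : S.Out x), (⟨x, o⟩ : S.Event) ∈ A → (⟨x, o'⟩ : S.Event) ∈ A → o = o') :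
    e.graphWeight A = 0 :=
  dif_neg fun h' => h h'.2

theorem graphWeight_eq (e : EmpiricalModel S) (A : Set S.Event) (σ : Set S.Meas)
    (hσ : σ ∈ S.contexts) (s : S.Sections σ)
    (hA : ∀ x o, (⟨x, o⟩ : S.Event) ∈ A ↔ ∃ hx : x ∈ σ, s ⟨x, hx⟩ = o) :
    e.graphWeight A = (e.dist σ hσ).weights s := by
  have hdom : {x | ∃ o, (⟨x, o⟩ : S.Event) ∈ A} = σ := by
    ext x
    constructor
    · rintro ⟨o, ho⟩
      exact ((hA x o).1 ho).1
    · intro hx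
      exact ⟨s ⟨x, hx⟩, (hA x _).2 ⟨hx, rfl⟩⟩
  have h : {x | ∃ o, (⟨x, o⟩ : S.Event) ∈ A} ∈ S.contexts ∧
      ∀ x (o o' : S.Out x), (⟨x, o⟩ : S.Event) ∈ A → (⟨x, o'⟩ : S.Event) ∈ A → o = o' := by
    refine ⟨hdom ▸ hσ, fun x o o' ho ho' => ?_⟩
    obtain ⟨_, rfl⟩ := (hA x o).1 ho
    obtain ⟨_, rfl⟩ := (hA x o').1 ho'
    rfl
  rw [graphWeight, dif_pos h]
  refine e.weights_congr _ _ hdom _ _ fun x hx hx' => ?_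
  obtain ⟨_, h2⟩ := (hA x _).1 hx.choose_spec
  exact h2.symm

/-- Marginalization, stated for graphs. -/
theorem graphWeight_eq_sum (e : EmpiricalModel S) (A : Set S.Event) (x : S.Meas)
    (hx : (∀ x (o o' : S.Out x), (⟨x, o⟩ : S.Event) ∈ A → (⟨x, o'⟩ : S.Event) ∈ A → o = o') →
      insert x {x | ∃ o, (⟨x, o⟩ : S.Event) ∈ A} ∈ S.contexts) :
    e.graphWeight A = ∑ o : S.Out x, e.graphWeight (insert ⟨x, o⟩ A) := by
  classical
  by_cases hf : ∀ x (o o' : S.Out x), (⟨x, o⟩ : S.Event) ∈ A → (⟨x, o'⟩ : S.Event) ∈ A → o = o'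
  swap
  · rw [graphWeight_eq_zero e A hf]
    refine (Finset.sum_eq_zero fun o _ => graphWeight_eq_zero e _ fun h => hf ?_).symm
    exact fun y p p' hp hp' => h y p p' (Or.inr hp) (Or.inr hp')
  have hc := hx hf
  by_cases hxA : ∃ o, (⟨x, o⟩ : S.Event) ∈ A
  · obtain ⟨o, ho⟩ := hxA
    rw [Finset.sum_eq_single o, Set.insert_eq_of_mem ho]
    · intro o' _ hne
      refine graphWeight_eq_zero e _ fun h => hne ?_
      exact h x o' o (Set.mem_insert _ _) (Or.inr ho)
    · simp
  set σ : Set S.Meas := {x | ∃ o, (⟨x, o⟩ : S.Event) ∈ A} with hσdef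
  have hσ : σ ∈ S.contexts := S.down_closed _ hc _ (Set.subset_insert _ _)
  let s : S.Sections σ := fun y => y.2.choose
  have hs : ∀ y o, (⟨y, o⟩ : S.Event) ∈ A ↔ ∃ hy : y ∈ σ, s ⟨y, hy⟩ = o := by
    intro y o
    constructor
    · intro ho
      exact ⟨⟨o, ho⟩, hf y _ _ (Exists.choose_spec (⟨o, ho⟩ : y ∈ σ)) ho⟩
    · rintro ⟨hy, rfl⟩
      exact hy.choose_spec
  let t : S.Out x → S.Sections (insert x σ) := fun o y =>
    if h : y.1 = x then cast (congrArg S.Out h.symm) o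
    else s ⟨y.1, (Set.mem_insert_iff.1 y.2).resolve_left h⟩
  have htx : ∀ o, t o ⟨x, Set.mem_insert _ _⟩ = o := fun o => by simp [t]
  have hts : ∀ o y (hy : y ∈ σ), t o ⟨y, Set.mem_insert_of_mem _ hy⟩ = s ⟨y, hy⟩ := by
    intro o y hy
    have : y ≠ x := by rintro rfl; exact hxA hy
    simp [t, this]
  rw [graphWeight_eq e A σ hσ s hs,
    e.compat _ _ hc hσ (Set.subset_insert _ _), map_weights_apply]
  symm
  refine Finset.sum_bij (fun o _ => t o) ?_ ?_ ?_ ?_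
  · intro o _
    simp only [Finset.mem_filter, Finset.mem_univ, true_and]
    funext y
    exact hts o y.1 y.2
  · intro o _ o' _ h
    have := congrFun h ⟨x, Set.mem_insert _ _⟩
    rwa [htx, htx] at this
  · intro u hu
    simp only [Finset.mem_filter, Finset.mem_univ, true_and] at hu
    refine ⟨u ⟨x, Set.mem_insert _ _⟩, Finset.mem_univ _, ?_⟩
    funext ⟨y, hy⟩
    rcases Set.mem_insert_iff.1 hy with rfl | hy'
    · exact htx _
    · exact (hts _ y hy').trans (congrFun hu ⟨y, hy'⟩).symm
  · intro o _
    refine graphWeight_eq e _ _ hc (t o) fun y p => ?_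
    constructor
    · intro h
      rcases Set.mem_insert_iff.1 h with h | h
      · obtain ⟨rfl, h⟩ := Sigma.mk.inj_iff.1 h
        obtain rfl := eq_of_heq h
        exact ⟨Set.mem_insert _ _, htx _⟩
      · obtain ⟨hy, h'⟩ := (hs y p).1 h
        exact ⟨Set.mem_insert_of_mem _ hy, (hts o y hy).trans h'⟩
    · rintro ⟨hy, rfl⟩
      rcases Set.mem_insert_iff.1 hy with rfl | hy'
      · left; rw [htx]
      · right; rw [hts o y hy']; exact (hs y _).2 ⟨hy', rfl⟩

theorem mpWeight_eq (e : EmpiricalModel S) (τ : Set S.mp.Meas)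
    (hτ : τ ∈ S.mp.contexts) (s : S.mp.Sections τ) :
    e.mpWeight τ hτ s = e.graphWeight {p | ∃ Q : τ, p ∈ (s Q).1} := by
  classical
  by_cases h : ∀ Q Q' : τ, Consistent (s Q).1 (s Q').1
  · rw [mpWeight, dif_pos h]
    symm
    apply graphWeight_eq
    intro x o
    have key : ∀ hx : x ∈ ⋃ Q, support (s Q).1,
        ∃ Q, (⟨x, glue (fun Q => (s Q).1) ⟨x, hx⟩⟩ : S.Event) ∈ (s Q).1 := fun hx =>
      ⟨_, (Set.mem_iUnion.1 hx).choose_spec.choose_spec⟩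
    constructor
    · rintro ⟨Q, hQ⟩
      have hx : x ∈ ⋃ Q, support (s Q).1 := Set.mem_iUnion.2 ⟨Q, o, hQ⟩
      obtain ⟨Q', hQ'⟩ := key hx
      exact ⟨hx, h Q' Q x _ _ hQ' hQ⟩
    · rintro ⟨hx, rfl⟩
      exact key hx
  · rw [mpWeight, dif_neg h, graphWeight_eq_zero]
    intro h'
    exact h fun Q Q' x o o' ho ho' => h' x o o' ⟨Q, ho⟩ ⟨Q', ho'⟩

open Classical in
theorem graphWeight_aux (e : EmpiricalModel S) (τ : Set S.mp.Meas)
    (hτ : τ ∈ S.mp.contexts) (r : τ → List S.Event)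
    (hr : ∀ Q : τ, r Q ∈ (Q.1 : Protocol S).runs)
    (ih : ∀ r' : τ → List S.Event, (∀ Q : τ, r' Q ∈ (Q.1 : Protocol S).runs) →
      ∑ᶠ Q, (r Q).length < ∑ᶠ Q, (r' Q).length →
      e.graphWeight {p | ∃ Q : τ, p ∈ r' Q} =
        ∑ s : S.mp.Sections τ,
          if ∀ Q, r' Q <+: (s Q).1 then e.graphWeight {p | ∃ Q : τ, p ∈ (s Q).1} else 0) :
    e.graphWeight {p | ∃ Q : τ, p ∈ r Q} =
      ∑ s : S.mp.Sections τ,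
        if ∀ Q, r Q <+: (s Q).1 then e.graphWeight {p | ∃ Q : τ, p ∈ (s Q).1} else 0 := by
  have : Fintype τ := Fintype.ofFinite _
  simp only [finsum_eq_sum_of_fintype] at ih
  by_cases hmax : ∀ Q : τ, (Q.1 : Protocol S).IsMaximal (r Q)
  · let s0 : S.mp.Sections τ := fun Q => ⟨r Q, hmax Q⟩
    rw [Finset.sum_eq_single s0]
    · rw [if_pos fun Q => List.prefix_rfl]
    · intro s _ hs
      refine if_neg fun h => hs ?_
      funext Q
      exact Subtype.ext ((hmax Q).2 _ (s Q).2.1 (h Q))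
    · simp
  obtain ⟨Q0, hQ0⟩ := not_forall.1 hmax
  have next : ∀ l ∈ (Q0.1 : Protocol S).runs, r Q0 <+: l → l ≠ r Q0 →
      ∃ x o, r Q0 ++ [(⟨x, o⟩ : S.Event)] <+: l ∧
        r Q0 ++ [(⟨x, o⟩ : S.Event)] ∈ (Q0.1 : Protocol S).runs := by
    rintro l hl ⟨l', rfl⟩ hne
    match l', hne, hl with
    | [], hne, _ => simp at hne
    | ⟨x, o⟩ :: l', _, hl =>
      refine ⟨x, o, ⟨l', by simp⟩, Protocol.prefix_closed _ _ l' (by simpa using hl)⟩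
  obtain ⟨x, hx⟩ : ∃ x, ∀ o : S.Out x,
      r Q0 ++ [(⟨x, o⟩ : S.Event)] ∈ (Q0.1 : Protocol S).runs := by
    by_contra! hcon
    refine hQ0 ⟨hr Q0, fun l hl hp => ?_⟩
    by_contra hne
    obtain ⟨x, o, -, ho⟩ := next l hl hp hne
    obtain ⟨o', ho'⟩ := hcon x
    exact ho' (Protocol.all_outcomes _ _ _ _ _ ho)
  let r' : S.Out x → τ → List S.Event := fun o =>
    Function.update r Q0 (r Q0 ++ [(⟨x, o⟩ : S.Event)])
  have hr'0 : ∀ o, r' o Q0 = r Q0 ++ [(⟨x, o⟩ : S.Event)] := fun o => by simp [r']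
  have hr'ne : ∀ o Q, Q ≠ Q0 → r' o Q = r Q := fun o Q h => by simp [r', h]
  have hr'mem : ∀ o (Q : τ), r' o Q ∈ (Q.1 : Protocol S).runs := by
    intro o Q
    by_cases h : Q = Q0
    · subst h; rw [hr'0]; exact hx o
    · rw [hr'ne o Q h]; exact hr Q
  have hpre : ∀ o Q, r Q <+: r' o Q := by
    intro o Q
    by_cases h : Q = Q0
    · subst h; rw [hr'0]; exact List.prefix_append _ _
    · rw [hr'ne o Q h]
  have hset : ∀ o, {p | ∃ Q, p ∈ r' o Q} = insert ⟨x, o⟩ {p | ∃ Q, p ∈ r Q} := by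
    intro o
    ext p
    constructor
    · rintro ⟨Q, hQ⟩
      by_cases h : Q = Q0
      · subst h
        rw [hr'0, List.mem_append, List.mem_singleton] at hQ
        exact hQ.elim (fun h => Or.inr ⟨_, h⟩) Or.inl
      · rw [hr'ne o Q h] at hQ
        exact Or.inr ⟨Q, hQ⟩
    · rintro (rfl | ⟨Q, hQ⟩)
      · exact ⟨Q0, by rw [hr'0]; simp⟩
      · exact ⟨Q, (hpre o Q).subset hQ⟩
  have hlen : ∀ o, ∑ Q, (r Q).length < ∑ Q, (r' o Q).length := fun o =>
    Finset.sum_lt_sum (fun Q _ => (hpre o Q).length_le) ⟨Q0, Finset.mem_univ _, by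
      rw [hr'0]; simp⟩
  rw [graphWeight_eq_sum e _ x]
  · have h1 : ∀ o : S.Out x, e.graphWeight (insert ⟨x, o⟩ {p | ∃ Q, p ∈ r Q}) =
        ∑ s : S.mp.Sections τ, if ∀ Q, r' o Q <+: (s Q).1 then
          e.graphWeight {p | ∃ Q : τ, p ∈ (s Q).1} else 0 := fun o => by
      rw [← hset o, ih _ (hr'mem o) (hlen o)]
      refine Finset.sum_congr rfl fun s _ => ?_
      congr
    rw [Finset.sum_congr rfl fun o _ => h1 o, Finset.sum_comm]
    refine Finset.sum_congr rfl fun s _ => ?_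
    by_cases hs : ∀ Q, r Q <+: (s Q).1
    · rw [if_pos hs]
      have hne : (s Q0).1 ≠ r Q0 := by
        intro h
        exact hQ0 (h ▸ (s Q0).2)
      obtain ⟨y, o, hpo, ho⟩ := next _ (s Q0).2.1 (hs Q0) hne
      obtain rfl : x = y :=
        Protocol.deterministic _ _ _ _ (Classical.arbitrary _) o (hx _) ho
      rw [Finset.sum_eq_single o]
      · refine if_pos fun Q => ?_
        by_cases h : Q = Q0
        · subst h; rw [hr'0]; exact hpo
        · rw [hr'ne o Q h]; exact hs Q
      · intro o' _ hne'
        refine if_neg fun h => hne' ?_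
        have h2 := h Q0
        rw [hr'0] at h2
        have h3 := (List.prefix_of_prefix_length_le h2 hpo (by simp)).eq_of_length (by simp)
        simpa using h3
      · simp
    · rw [if_neg hs]
      exact Finset.sum_eq_zero fun o _ => if_neg fun h => hs fun Q => (hpre o Q).trans (h Q)
  · intro hf
    obtain ⟨o, ho⟩ : ∃ o : S.Out x, ∀ o', (⟨x, o'⟩ : S.Event) ∈ {p | ∃ Q, p ∈ r Q} → o = o' := by
      by_cases h : ∃ o, (⟨x, o⟩ : S.Event) ∈ {p | ∃ Q, p ∈ r Q}
      · obtain ⟨o, ho⟩ := h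
        exact ⟨o, fun o' ho' => hf x o o' ho ho'⟩
      · exact ⟨Classical.arbitrary _, fun o' ho' => (h ⟨o', ho'⟩).elim⟩
    have hc := hτ (r' o) (hr'mem o) (by
      intro Q Q' y p p' hp hp'
      replace hp : (⟨y, p⟩ : S.Event) ∈ insert (⟨x, o⟩ : S.Event) {p | ∃ Q, p ∈ r Q} := by
        rw [← hset o]; exact ⟨Q, hp⟩
      replace hp' : (⟨y, p'⟩ : S.Event) ∈ insert (⟨x, o⟩ : S.Event) {p | ∃ Q, p ∈ r Q} := by
        rw [← hset o]; exact ⟨Q', hp'⟩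
      rcases hp with hp | hp
      · obtain ⟨rfl, h⟩ := Sigma.mk.inj_iff.1 hp
        obtain rfl := eq_of_heq h
        rcases hp' with hp' | hp'
        · exact (eq_of_heq (Sigma.mk.inj_iff.1 hp').2).symm
        · exact ho _ hp'
      · rcases hp' with hp' | hp'
        · obtain ⟨rfl, h⟩ := Sigma.mk.inj_iff.1 hp'
          obtain rfl := eq_of_heq h
          exact (ho _ hp).symm
        · exact hf _ _ _ hp hp')
    refine S.down_closed _ hc _ ?_
    rintro y (rfl | ⟨p, Q, hp⟩)
    · exact Set.mem_iUnion.2 ⟨Q0, o, by rw [hr'0]; simp⟩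
    · exact Set.mem_iUnion.2 ⟨Q, p, (hpre o Q).subset hp⟩

open Classical in
theorem graphWeight_eq_sum_outcomes (e : EmpiricalModel S) (τ : Set S.mp.Meas)
    (hτ : τ ∈ S.mp.contexts) (n : ℕ) :
    ∀ r : τ → List S.Event, (∀ Q : τ, r Q ∈ (Q.1 : Protocol S).runs) →
      Nat.card τ * Nat.card S.Meas ≤ (∑ᶠ Q, (r Q).length) + n →
      e.graphWeight {p | ∃ Q : τ, p ∈ r Q} =
        ∑ s : S.mp.Sections τ,
          if ∀ Q, r Q <+: (s Q).1 then e.graphWeight {p | ∃ Q : τ, p ∈ (s Q).1} else 0 := by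
  induction n with
  | zero =>
    intro r hr hn
    refine graphWeight_aux e τ hτ r hr fun r' hr' hlt => ?_
    exfalso
    have : Fintype τ := Fintype.ofFinite _
    simp only [finsum_eq_sum_of_fintype, Nat.card_eq_fintype_card (α := τ)] at hn hlt
    have : ∑ Q, (r' Q).length ≤ ∑ _Q : τ, Nat.card S.Meas :=
      Finset.sum_le_sum fun Q _ => (Protocol.isRun _ _ (hr' Q)).length_le
    simp only [Finset.sum_const, Finset.card_univ, smul_eq_mul] at this
    omega
  | succ n ih =>
    intro r hr hn
    exact graphWeight_aux e τ hτ r hr fun r' hr' hlt => ih r' hr' (by omega)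

open Classical in
/-- Summing over all joint outcomes that extend a joint outcome of fewer protocols. -/
theorem sum_mpWeight (e : EmpiricalModel S) (τ τ' : Set S.mp.Meas) (hτ : τ ∈ S.mp.contexts)
    (hτ' : τ' ∈ S.mp.contexts) (h : τ' ⊆ τ) (t : S.mp.Sections τ') :
    (∑ s : S.mp.Sections τ, if Set.domRestrict₂ h s = t then e.mpWeight τ hτ s else 0) =
      e.mpWeight τ' hτ' t := by
  let r : τ → List S.Event := fun Q => if hQ : Q.1 ∈ τ' then (t ⟨Q.1, hQ⟩).1 else []
  have hr1 : ∀ (Q : τ) (hQ : Q.1 ∈ τ'), r Q = (t ⟨Q.1, hQ⟩).1 := fun Q hQ => dif_pos hQ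
  have hr2 : ∀ (Q : τ), Q.1 ∉ τ' → r Q = [] := fun Q hQ => dif_neg hQ
  have hr : ∀ Q : τ, r Q ∈ (Q.1 : Protocol S).runs := by
    intro Q
    by_cases hQ : Q.1 ∈ τ'
    · rw [hr1 Q hQ]; exact (t ⟨Q.1, hQ⟩).2.1
    · rw [hr2 Q hQ]; exact Protocol.nil_mem _
  have key := graphWeight_eq_sum_outcomes e τ hτ _ r hr (Nat.le_add_left _ _)
  have hset : {p | ∃ Q : τ, p ∈ r Q} = {p | ∃ Q : τ', p ∈ (t Q).1} := by
    ext p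
    constructor
    · rintro ⟨Q, hp⟩
      by_cases hQ : Q.1 ∈ τ'
      · rw [hr1 Q hQ] at hp; exact ⟨_, hp⟩
      · rw [hr2 Q hQ] at hp; simp at hp
    · rintro ⟨Q, hp⟩
      exact ⟨⟨Q.1, h Q.2⟩, by rw [hr1 _ Q.2]; exact hp⟩
  rw [mpWeight_eq, ← hset, key]
  refine Finset.sum_congr rfl fun s _ => ?_
  rw [mpWeight_eq]
  refine if_congr ?_ rfl rfl
  constructor
  · rintro rfl Q
    by_cases hQ : Q.1 ∈ τ'
    · rw [hr1 Q hQ]; exact List.prefix_rfl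
    · rw [hr2 Q hQ]; exact List.nil_prefix
  · intro hs
    funext Q
    have h1 := hs ⟨Q.1, h Q.2⟩
    rw [hr1 _ Q.2] at h1
    exact Subtype.ext ((t Q).2.2 _ (s ⟨Q.1, h Q.2⟩).2.1 h1)

theorem mpWeight_nonneg (e : EmpiricalModel S) (τ : Set S.mp.Meas) (hτ : τ ∈ S.mp.contexts)
    (s : S.mp.Sections τ) : 0 ≤ e.mpWeight τ hτ s := by
  unfold mpWeight
  split_ifs
  · exact StdSimplex.weights_nonneg _
  · exact le_rfl

theorem mpWeight_total (e : EmpiricalModel S) (τ : Set S.mp.Meas) (hτ : τ ∈ S.mp.contexts) :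
    ∑ s, e.mpWeight τ hτ s = 1 := by
  classical
  let t : S.mp.Sections ∅ := fun Q => Q.2.elim
  have h1 := sum_mpWeight e τ ∅ hτ S.mp.empty_mem (Set.empty_subset τ) t
  have h2 : ∑ s, e.mpWeight τ hτ s = e.mpWeight ∅ S.mp.empty_mem t := by
    rw [← h1]
    exact Finset.sum_congr rfl fun s _ => (if_pos (funext fun Q => Q.2.elim)).symm
  rw [h2, mpWeight_eq, graphWeight_eq e _ ∅ S.empty_mem (fun x => x.2.elim)
    (by
      intro x o
      constructor
      · rintro ⟨Q, _⟩; exact Q.2.elim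
      · rintro ⟨hx, _⟩; exact hx.elim),
    ← sum_weights (e.dist ∅ S.empty_mem)]
  symm
  refine Finset.sum_eq_single _ (fun s _ hs => (hs ?_).elim)
    (fun h => (h (Finset.mem_univ _)).elim)
  exact funext fun x => x.2.elim

/-- The empirical model of measurement protocols on `e`. -/
noncomputable def mp (e : EmpiricalModel S) : EmpiricalModel S.mp where
  dist τ hτ := distOfFun (e.mpWeight τ hτ) (e.mpWeight_nonneg τ hτ) (e.mpWeight_total τ hτ)
  compat τ τ' hτ hτ' h := by
    classical
    ext t
    rw [map_weights_apply, distOfFun_apply, ← e.sum_mpWeight τ τ' hτ hτ' h t,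
      Finset.sum_filter]
    exact Finset.sum_congr rfl fun s _ => if_congr Iff.rfl rfl rfl

end EmpiricalModel

/-! ### Simulations -/

/-- `d` simulates `e`: for some non-contextual model `c`, there is a deterministic simulation
from the model of measurement protocols on `d ⊗ c` to `e`. -/
def Simulates {T : Scenario.{v}} {S : Scenario.{u}} (d : EmpiricalModel T)
    (e : EmpiricalModel S) : Prop :=
  ∃ (C : Scenario.{v}) (c : EmpiricalModel C), c.NonContextual ∧
    ∃ f : DetMorphism (T.tensor C).mp S, e = f.push (d.tensor c).mp

end Contextuality

namespace Contextuality

open Scenario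

/-! ### Lower bounds for the non-contextual fraction from weighted global assignments. -/

namespace EmpiricalModel

/-! The non-contextual fraction is the value of a linear program: the largest total mass of a
non-negative weight on global assignments whose marginal on every context lies pointwise below the
model (`IsSubweight`). An optimal weight for `d` can therefore be transported, without loss of mass,
through each of the three constructions of which a simulation is composed; the remainder `e'` of the
decomposition never has to be followed.

For `d ⊗ c`, take the product of the weight with a global distribution for `c`, which has mass one
(`ncf_le_ncf_tensor`). For measurement protocols, a global assignment answers every question that a
protocol can ask, so it selects one maximal run of each protocol, and runs selected by the same
assignment are consistent (`Protocol.exists_isMaximal`, `ncf_le_ncf_mp`). For a deterministic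
morphism, reinterpret the outcomes of each assignment (`ncf_le_ncf_push`).

In each case the new weight is the image of the old one under a map of global assignments.
`sum_le_ncf` reduces the claim to a comparison of marginals, and `isGreatest_ncf` supplies the
optimal weight at the start and the upper bound at the end. -/

open scoped Classical in
/-- A finite family of non-negatively weighted global assignments whose marginals lie below `e`
bounds the non-contextual fraction of `e` from below. -/
theorem sum_le_ncf {S : Scenario.{u}} (e : EmpiricalModel S) {A : Type*} [Fintype A]
    (b : A → ℝ) (F : A → S.Global) (h0 : ∀ a, 0 ≤ b a)
    (h : ∀ (σ : Set S.Meas) (hσ : σ ∈ S.contexts) (s : S.Sections σ),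
      ∑ a, (if Set.domRestrict σ (F a) = s then b a else 0) ≤ (e.dist σ hσ).weights s) :
    ∑ a, b a ≤ e.ncf := by
  -- This is the image of `b` under `F`; weights are added up because `F` need not be injective.
  have hb : e.IsSubweight fun g => ∑ a, if F a = g then b a else 0 := by
    refine ⟨fun g => Finset.sum_nonneg fun a _ => ?_,
      fun σ hσ s => le_trans (le_of_eq ?_) (h σ hσ s)⟩
    · split_ifs
      exacts [h0 a, le_rfl]
    · simp only [← Finset.sum_filter]
      -- The sum runs over pairs `(g, a)` with `F a = g` and `g` restricting to `s`. With `a`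
      -- outermost, `g` is forced to be `F a`.
      rw [Finset.sum_comm' (t' := Finset.univ.filter fun a => Set.domRestrict σ (F a) = s)
        (s' := fun a => {F a})]
      · simp
      · intro g a
        simp only [Finset.mem_filter, Finset.mem_univ, true_and, Finset.mem_singleton]
        constructor
        · rintro ⟨h1, rfl⟩
          exact ⟨rfl, h1⟩
        · rintro ⟨rfl, h1⟩
          exact ⟨h1, rfl⟩
  refine le_trans (le_of_eq ?_) (e.isGreatest_ncf.2 hb.mem)
  rw [Finset.sum_comm]
  simp

/-- The non-contextual fraction is the total mass of a subweight. -/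
theorem exists_isSubweight_ncf {S : Scenario.{u}} (e : EmpiricalModel S) :
    ∃ b, e.IsSubweight b ∧ ∑ g, b g = e.ncf :=
  exists_isSubweight e.isGreatest_ncf.1

/-! ### Deterministic morphisms and tensor products. -/

/-- The non-contextual fraction does not decrease under pushforward along deterministic
morphisms. -/
theorem ncf_le_ncf_push {T : Scenario.{v}} {S : Scenario.{u}} (f : DetMorphism T S)
    (d : EmpiricalModel T) : d.ncf ≤ (f.push d).ncf := by
  classical
  obtain ⟨b, hb, hsum⟩ := d.exists_isSubweight_ncf
  rw [← hsum]
  -- The new assignment answers `x` by looking up `f.toFun x` in `g` and translating the outcome.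
  -- Restricting it to `σ` gives `f.onSections σ` of the restriction of `g` to the image of `σ`, by
  -- definition.
  refine sum_le_ncf _ b (fun g x => f.out x (g (f.toFun x))) hb.1 fun σ hσ s => ?_
  rw [DetMorphism.push, map_weights_apply]
  -- The bounds on the marginals of `b` are added over the fibre of `f.onSections σ` above `s`. Each
  -- `g` is counted at most once there, since it has a single restriction to the image of `σ`.
  refine le_trans (le_of_eq ?_)
    (Finset.sum_le_sum fun t _ => hb.2 (f.toFun '' σ) (f.simplicial σ hσ) t)
  rw [Finset.sum_comm]
  refine Finset.sum_congr rfl fun g _ => ?_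
  rw [Finset.sum_filter, Finset.sum_eq_single (Set.domRestrict (f.toFun '' σ) g)]
  · rw [if_pos rfl]
    rfl
  · intro t _ ht
    rw [if_neg ht.symm, ite_self]
  · simp

/-- Tensoring with a non-contextual model does not decrease the non-contextual fraction. -/
theorem ncf_le_ncf_tensor {T C : Scenario.{u}} (d : EmpiricalModel T) (c : EmpiricalModel C)
    (hc : c.NonContextual) : d.ncf ≤ (d.tensor c).ncf := by
  classical
  obtain ⟨b, hb, hsum⟩ := d.exists_isSubweight_ncf
  obtain ⟨p, hp⟩ := hc
  let F : T.Global × C.Global → (T.tensor C).Global := fun g x => match x with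
    | Sum.inl x => g.1 x
    | Sum.inr x => g.2 x
  -- The product weight keeps the mass of `b` because `p` has total mass one.
  have htot : ∑ g : T.Global × C.Global, b g.1 * p.weights g.2 = d.ncf := by
    rw [Fintype.sum_prod_type, ← Fintype.sum_mul_sum, sum_weights, mul_one, hsum]
  rw [← htot]
  refine sum_le_ncf _ _ F
    (fun g => mul_nonneg (hb.1 _) (StdSimplex.weights_nonneg _)) fun ρ hρ s => ?_
  have hF : ∀ g, Set.domRestrict ρ (F g) = s ↔
      Set.domRestrict (inl C ⁻¹' ρ) g.1 = (secEquiv ρ s).1 ∧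
        Set.domRestrict (inr T ⁻¹' ρ) g.2 = (secEquiv ρ s).2 := fun g => by
    rw [← (secEquiv ρ).injective.eq_iff, Prod.ext_iff]
    rfl
  -- The condition of restricting to `s` splits into one condition per factor, so the marginal of
  -- the product weight is the product of the marginals.
  have hsplit : ∑ g : T.Global × C.Global,
      (if Set.domRestrict ρ (F g) = s then b g.1 * p.weights g.2 else 0) =
      (∑ g, if Set.domRestrict (inl C ⁻¹' ρ) g = (secEquiv ρ s).1 then b g else 0) *
        ∑ g, if Set.domRestrict (inr T ⁻¹' ρ) g = (secEquiv ρ s).2 then p.weights g else 0 := by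
    rw [Fintype.sum_mul_sum, ← Fintype.sum_prod_type']
    refine Finset.sum_congr rfl fun g _ => ?_
    rw [ite_zero_mul_ite_zero]
    exact if_congr (hF g) rfl rfl
  -- The second factor is exactly the probability under `c`, since `p` realises `c`. Only the first
  -- factor has to be estimated.
  rw [hsplit, tensor, distOfFun_apply, ← hp _ (right_mem hρ), map_weights_apply,
    Finset.sum_filter]
  refine mul_le_mul_of_nonneg_right (hb.2 _ (left_mem hρ) _) (Finset.sum_nonneg fun g _ => ?_)
  split_ifs
  exacts [StdSimplex.weights_nonneg _, le_rfl]

end EmpiricalModel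

/-! ### Measurement protocols. -/

/-- Every global assignment determines a maximal run of each protocol. -/
theorem Protocol.exists_isMaximal {S : Scenario.{u}} (Q : Protocol S) (g : S.Global) :
    ∃ l, Q.IsMaximal l ∧ ∀ x o, (⟨x, o⟩ : S.Event) ∈ l → g x = o := by
  -- Lengths of the runs of `Q` whose outcomes are those prescribed by `g`. They are bounded because
  -- a run never repeats a measurement, and the empty run provides one, so a longest such run
  -- exists.
  let A : Set ℕ :=
    {n | ∃ l ∈ Q.runs, (∀ x o, (⟨x, o⟩ : S.Event) ∈ l → g x = o) ∧ l.length = n}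
  have hb : BddAbove A := ⟨Nat.card S.Meas, by
    rintro _ ⟨l, hl, -, rfl⟩
    exact (Q.isRun l hl).length_le⟩
  obtain ⟨l, hl, hg, hn⟩ := Nat.sSup_mem (s := A) ⟨0, [], Q.nil_mem, by simp, rfl⟩ hb
  refine ⟨l, ⟨hl, ?_⟩, hg⟩
  rintro _ hl' ⟨m, rfl⟩
  match m, hl' with
  | [], _ => simp
  | ⟨x, o⟩ :: m, hl' =>
    -- If `l` could be prolonged by measuring `x`, with whatever outcome `o`, then `all_outcomes`
    -- would also allow the outcome `g x`. That gives a longer run following `g`, against the choice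
    -- of `l`.
    have hx : l ++ [(⟨x, g x⟩ : S.Event)] ∈ Q.runs :=
      Q.all_outcomes _ _ o _ (Q.prefix_closed _ m (by simpa using hl'))
    have hmem : (l ++ [(⟨x, g x⟩ : S.Event)]).length ∈ A := by
      refine ⟨_, hx, fun y p hy => ?_, rfl⟩
      rcases List.mem_append.1 hy with hy | hy
      · exact hg y p hy
      · obtain ⟨rfl, h⟩ := Sigma.mk.inj_iff.1 (List.mem_singleton.1 hy)
        exact (eq_of_heq h).symm
    have := le_csSup hb hmem
    rw [List.length_append, List.length_singleton] at this
    omega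

namespace EmpiricalModel

/-- Passing to measurement protocols does not decrease the non-contextual fraction. -/
theorem ncf_le_ncf_mp {S : Scenario.{u}} (e : EmpiricalModel S) : e.ncf ≤ e.mp.ncf := by
  classical
  obtain ⟨b, hb, hsum⟩ := e.exists_isSubweight_ncf
  rw [← hsum]
  choose run hmax hrun using fun (g : S.Global) (Q : Protocol S) => Q.exists_isMaximal g
  refine sum_le_ncf _ b (fun g Q => ⟨run g Q, hmax g Q⟩) hb.1 fun τ hτ s => ?_
  -- If `g` selects the runs in `s`, every outcome recorded in them is the value of `g`. This one
  -- implication suffices, as the marginals need only be bounded above.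
  have hagree : ∀ g : S.Global,
      Set.domRestrict (π := S.mp.Out) τ (fun Q => ⟨run g Q, hmax g Q⟩) = s →
      ∀ (Q : τ) x o, (⟨x, o⟩ : S.Event) ∈ (s Q).1 → g x = o := by
    rintro g rfl Q x o h
    exact hrun g Q.1 x o h
  rw [mp, distOfFun_apply, mpWeight]
  split_ifs with h
  -- Consistent runs: every `g` that selects `s` restricts to the glued assignment on the union of
  -- the contexts. The sum is thus bounded termwise by the marginal of `b` there, hence by `e`.
  · refine le_trans (Finset.sum_le_sum fun g _ => ?_) (hb.2 _ _ _)
    by_cases hg : Set.domRestrict (π := S.mp.Out) τ (fun Q => ⟨run g Q, hmax g Q⟩) = s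
    · rw [if_pos hg, if_pos]
      funext x
      exact hagree g hg _ x.1 _ (Set.mem_iUnion.1 x.2).choose_spec.choose_spec
    · rw [if_neg hg]
      split_ifs
      exacts [hb.1 g, le_rfl]
  -- Inconsistent runs: two recorded outcomes of one measurement would both equal the value of `g`,
  -- so no `g` selects `s` and both sides vanish.
  · refine le_of_eq (Finset.sum_eq_zero fun g _ => if_neg fun hg => h ?_)
    intro Q Q' x o o' ho ho'
    exact (hagree g hg Q x o ho).symm.trans (hagree g hg Q' x o' ho')

end EmpiricalModel

end Contextuality

/-! ### Monotonicity under simulation. -/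

theorem mainTheorem4 {T : Contextuality.Scenario.{v}} {S : Contextuality.Scenario.{u}}
    (d : Contextuality.EmpiricalModel T) (e : Contextuality.EmpiricalModel S)
    (h : Contextuality.Simulates d e) :
    d.ncf ≤ e.ncf ∧ e.cf ≤ d.cf := by
  obtain ⟨C, c, hc, f, rfl⟩ := h
  -- The fraction is followed from `d` to `d ⊗ c`, then to the protocols on `d ⊗ c`, then to the
  -- pushforward, which is `e`.
  have hle := (d.ncf_le_ncf_tensor c hc).trans
    ((d.tensor c).ncf_le_ncf_mp.trans (Contextuality.EmpiricalModel.ncf_le_ncf_push f _))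
  exact ⟨hle, sub_le_sub_left hle 1⟩
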